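/- Let $q>2$ be an odd prime power and let $\mathbb{F}_q$ be the field with $q$ elements. For a permutation $\sigma$ of $\mathbb{F}_q$, a collinear triple of $\sigma$ is a set of three distinct points of its graph $\{(x,\sigma(x)) : x\in\mathbb{F}_q\}$ that lie on a common line of the affine plane $\mathbb{F}_q^2$. The minimum number of collinear triples over all permutations of $\mathbb{F}_q$ is $(q-1)/2$. Moreover, every permutation $\sigma$ of $\mathbb{F}_q$ with exactly $(q-1)/2$ collinear triples is an extended linear fractional transformation permutation (ELFTP): there are $\alpha,\beta,\gamma\in\mathbb{F}_q$ with $\alpha\gamma\neq\beta$ such that $$\sigma(x)=\frac{\alpha x+\beta}{x+\gamma}\quad\text{for all } x\neq-\gamma,\qquad \sigma(-\gamma)=\alpha.$$ -/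

import Mathlib

/-- The graph of a permutation `σ` of `F`, as a set of points of the affine plane `F × F`. -/
def permGraph {F : Type*} (σ : Equiv.Perm F) : Set (F × F) :=
  {P | P.2 = σ P.1}

/-- The collinear triples of a permutation `σ` of `F`: the sets of three distinct points of the
graph of `σ` that lie on a common line of the affine plane `F × F`. -/
def collinearTriples {F : Type*} [Field F] (σ : Equiv.Perm F) : Set (Finset (F × F)) :=
  {T | T.card = 3 ∧ (T : Set (F × F)) ⊆ permGraph σ ∧ Collinear F (T : Set (F × F))}

/-- Extended linear fractional transformation permutations: the functions `f` with
`f x = (α x + β) / (x + γ)` for `x ≠ -γ` and `f (-γ) = α`, for parameters with `α γ ≠ β`. -/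
def IsELFTP {F : Type*} [Field F] (f : F → F) : Prop :=
  ∃ α β γ : F, α * γ ≠ β ∧ (∀ x : F, x ≠ -γ → f x = (α * x + β) / (x + γ)) ∧ f (-γ) = α

open Finset

/-! ### Wilson-type products of slopes -/

section WilsonProducts

variable {F : Type*} [Field F]

/-! By Wilson's theorem the slopes from a graph point to the others multiply to `1`, while the
nonzero field elements multiply to `-1`; so some slope repeats and every point lies on a collinear
triple. Call a point simple if it lies on exactly one, and let `m` be its repeated slope. Its slopes
then omit exactly `0` and `-m`, which fixes products of slope differences. Comparing two simple
points gives `u ^ 2 = m * n` for their joining slope `u` (`slope_sq`), which forces four or more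
simple points onto a hyperbola (`exists_hyperbola`).

Let `N` be the number of triples, `n` that of simple points, `t x` that of triples through `x`. Then
`∑ t x = 3N` gives `2q ≤ 3N + n`. If no triple contains two simple points, `n ≤ N` and `2N ≥ q`.
Otherwise the centre `a` of the hyperbola is on the graph and every simple point's triple passes
through it, so `n ≤ 2 t a`. Counting away from `a` gives `2(q - 1) ≤ 3N - t a + n ≤ 3N + n / 2`, and
`n ≤ q - 1` yields the bound. Equality makes every other point simple, hence on the hyperbola. The
map `x ↦ x⁻¹`, `0 ↦ 0` attains the bound. -/

theorem slope_perm_ne_zero (σ : Equiv.Perm F) {x y : F} (h : x ≠ y) : slope σ x y ≠ 0 := by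
  rw [slope_def_field]
  exact div_ne_zero (sub_ne_zero.2 fun e => h (σ.injective e).symm) (sub_ne_zero.2 h.symm)

/-- Both sides are the vertical offset of the point over `w` from the line joining the points over
`p` and `q`. -/
theorem slope_sub_mul (σ : Equiv.Perm F) {p q w : F} (hp : w ≠ p) (hq : w ≠ q) (hpq : p ≠ q) :
    (slope σ p w - slope σ p q) * (w - p) = (slope σ q w - slope σ p q) * (w - q) := by
  simp only [slope_def_field]
  have := sub_ne_zero.2 hp
  have := sub_ne_zero.2 hq
  have := sub_ne_zero.2 hpq.symm
  field_simp
  ring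

theorem slope_eq_slope_of_slope_eq (σ : Equiv.Perm F) {x y z : F} (hxy : x ≠ y) (hxz : x ≠ z)
    (hyz : y ≠ z) (h : slope σ x y = slope σ x z) : slope σ y z = slope σ x y := by
  have h1 := slope_sub_mul σ hxz.symm hyz.symm hxy
  rw [h, sub_self, zero_mul, eq_comm, mul_eq_zero, sub_eq_zero, sub_eq_zero] at h1
  rcases h1 with h1 | h1
  · rw [h1, h]
  · exact absurd h1.symm hyz

variable [Fintype F] [DecidableEq F]

theorem prod_erase_zero_eq_neg_one : ∏ v ∈ univ.erase (0 : F), v = -1 := by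
  have h : ∏ v ∈ univ.erase (0 : F), v = ∏ u : Fˣ, (u : F) := by
    symm
    refine Finset.prod_bij (fun u _ => (u : F)) ?_ ?_ ?_ ?_
    · intro u _; simp
    · intro u _ v _ h; exact Units.ext h
    · intro v hv; exact ⟨Units.mk0 v (by simpa using hv), by simp, by simp⟩
    · intros; rfl
  rw [h, ← Units.coe_prod, FiniteField.prod_univ_units_id_eq_neg_one]
  simp

theorem prod_erase_sub_eq_neg_one (u : F) : ∏ v ∈ univ.erase u, (v - u) = -1 := by
  rw [← prod_erase_zero_eq_neg_one (F := F)]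
  refine Finset.prod_bij (fun v _ => v - u) ?_ ?_ ?_ ?_
  · intro v hv; simpa [sub_eq_zero] using hv
  · intro v _ w _ h; simpa using h
  · intro v hv; exact ⟨v + u, by simpa using hv, by simp⟩
  · intros; rfl

theorem mul_prod_compl_pair (p q : F) (h : p ≠ q) :
    (q - p) * ∏ w ∈ ({p, q} : Finset F)ᶜ, (w - p) = -1 := by
  rw [← prod_erase_sub_eq_neg_one p, ← mul_prod_erase (univ.erase p) _ (a := q) (by simp [h.symm])]
  congr 2
  ext w; simp [and_comm]

theorem prod_slope_eq_one (σ : Equiv.Perm F) (x : F) :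
    ∏ w ∈ univ.erase x, slope σ x w = 1 := by
  simp only [slope_def_field, prod_div_distrib]
  have h : ∏ w ∈ univ.erase x, (σ w - σ x) = -1 := by
    rw [← prod_erase_sub_eq_neg_one (σ x)]
    refine Finset.prod_bij (fun v _ => σ v) ?_ ?_ ?_ ?_
    · intro v hv; simpa using hv
    · intro v _ w _ h; exact σ.injective h
    · intro v hv
      exact ⟨σ.symm v, by simpa [Equiv.symm_apply_eq] using hv, by simp⟩
    · intros; rfl
  rw [h, prod_erase_sub_eq_neg_one]
  simp

theorem exists_slope_eq (h2 : (2 : F) ≠ 0) (σ : Equiv.Perm F) (x : F) :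
    ∃ y z, x ≠ y ∧ x ≠ z ∧ y ≠ z ∧ slope σ x y = slope σ x z := by
  by_contra! hcon
  have hinj : Set.InjOn (slope σ x) (univ.erase x : Finset F) := by
    intro y hy z hz h
    simp only [coe_erase, coe_univ, Set.mem_sdiff, Set.mem_univ, Set.mem_singleton_iff,
      true_and] at hy hz
    by_contra hne
    exact hcon y z (Ne.symm hy) (Ne.symm hz) hne h
  have himg : (univ.erase x).image (slope σ x) = univ.erase 0 := by
    apply Finset.eq_of_subset_of_card_le
    · intro v hv
      obtain ⟨w, hw, rfl⟩ := mem_image.1 hv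
      simpa using slope_perm_ne_zero σ (Ne.symm (by simpa using hw))
    · rw [card_image_of_injOn hinj]; simp
  have h1 := prod_slope_eq_one σ x
  rw [← Finset.prod_image (f := fun v => v) hinj, himg, prod_erase_zero_eq_neg_one] at h1
  apply h2
  linear_combination -h1

end WilsonProducts

/-! ### Points on exactly one collinear triple -/

/-- The slopes of the lines joining the graph point over `x` to the other ones are pairwise
distinct, except that the points over `y` and `z` give the same slope. -/
structure IsSimpleAt {F : Type*} [Field F] (σ : Equiv.Perm F) (x y z : F) : Prop where
  ne_left : x ≠ y
  ne_right : x ≠ z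
  ne : y ≠ z
  slope_eq : slope σ x y = slope σ x z
  injOn : Set.InjOn (slope σ x) {w | w ≠ x ∧ w ≠ z}

namespace IsSimpleAt

variable {F : Type*} [Field F] {σ : Equiv.Perm F} {x y z : F}

theorem eq_or_eq (h : IsSimpleAt σ x y z) {w : F} (hw : w ≠ x) (hs : slope σ x w = slope σ x y) :
    w = y ∨ w = z := by
  by_cases hz : w = z
  · exact Or.inr hz
  · exact Or.inl (h.injOn ⟨hw, hz⟩ ⟨h.ne_left.symm, h.ne⟩ hs)

theorem slope_eq_of_slope_eq (h : IsSimpleAt σ x y z) {v w : F} (hv : v ≠ x) (hw : w ≠ x)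
    (hvw : v ≠ w) (hs : slope σ x v = slope σ x w) : slope σ x v = slope σ x y := by
  by_cases hvz : v = z
  · rw [hvz, h.slope_eq]
  by_cases hwz : w = z
  · rw [hs, hwz, h.slope_eq]
  exact absurd (h.injOn ⟨hv, hvz⟩ ⟨hw, hwz⟩ hs) hvw

theorem symm (h : IsSimpleAt σ x y z) : IsSimpleAt σ x z y where
  ne_left := h.ne_right
  ne_right := h.ne_left
  ne := h.ne.symm
  slope_eq := h.slope_eq.symm
  injOn := by
    rintro v ⟨hv, hv'⟩ w ⟨hw, hw'⟩ hs
    by_contra hne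
    have h1 := h.slope_eq_of_slope_eq hv hw hne hs
    rcases h.eq_or_eq hv h1 with h2 | h2
    · exact hv' h2
    rcases h.eq_or_eq hw (hs ▸ h1) with h3 | h3
    · exact hw' h3
    exact hne (h2.trans h3.symm)

theorem of_slope_eq (h : IsSimpleAt σ x y z) {v w : F} (hv : v ≠ x) (hw : w ≠ x)
    (hvw : v ≠ w) (hs : slope σ x v = slope σ x w) : IsSimpleAt σ x v w := by
  have h1 := h.slope_eq_of_slope_eq hv hw hvw hs
  rcases h.eq_or_eq hv h1 with rfl | rfl <;> rcases h.eq_or_eq hw (hs ▸ h1) with rfl | rfl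
  · exact absurd rfl hvw
  · exact h
  · exact h.symm
  · exact absurd rfl hvw

variable [Fintype F] [DecidableEq F]

/-- The remaining slopes are distinct, so just one nonzero value `t` is missed. Their product `P`
satisfies `m * P = 1` and `t * P = -1`, where `m` is the repeated slope; hence `t = -m`. -/
theorem image_slope (h : IsSimpleAt σ x y z) :
    (({x, z} : Finset F)ᶜ).image (slope σ x) = ({0, -slope σ x y} : Finset F)ᶜ := by
  have hinj : Set.InjOn (slope σ x) (({x, z} : Finset F)ᶜ : Finset F) := by
    refine h.injOn.mono fun w hw => ?_
    simpa [and_comm] using hw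
  set I := (({x, z} : Finset F)ᶜ).image (slope σ x) with hI
  have hm : slope σ x y ≠ 0 := slope_perm_ne_zero σ h.ne_left
  have h0 : (0 : F) ∉ I := by
    rw [hI, mem_image]
    rintro ⟨w, hw, hw0⟩
    refine slope_perm_ne_zero σ (x := x) (y := w) ?_ hw0
    rintro rfl
    simp at hw
  have hcard : #(Iᶜ.erase 0) = 1 := by
    rw [card_erase_of_mem (by simpa using h0), card_compl, hI, card_image_of_injOn hinj,
      card_compl, card_pair h.ne_right]
    have : 2 ≤ Fintype.card F := by
      rw [← card_pair h.ne_right]; exact card_le_univ _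
    omega
  obtain ⟨t, ht⟩ := card_eq_one.1 hcard
  have htI : t ∈ Iᶜ.erase 0 := by rw [ht]; simp
  have ht0 : t ≠ 0 := (mem_erase.1 htI).1
  have hIt : Iᶜ = {0, t} := by
    rw [← insert_erase (s := Iᶜ) (a := 0) (by simpa using h0), ht]
  have hprod : slope σ x y * ∏ v ∈ I, v = 1 := by
    rw [hI, prod_image hinj, h.slope_eq, ← prod_slope_eq_one σ x,
      ← mul_prod_erase (univ.erase x) _ (a := z) (by simp [h.ne_right.symm])]
    congr 2
    ext w; simp [and_comm]
  have hprod' : t * ∏ v ∈ I, v = -1 := by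
    rw [← prod_erase_zero_eq_neg_one (F := F), ← mul_prod_erase (univ.erase 0) _ (a := t)
      (by simp [ht0])]
    congr 2
    rw [← compl_compl I, hIt]
    ext w; simp [and_comm]
  have : t = -slope σ x y := by
    have hne : ∏ v ∈ I, v ≠ 0 := by
      intro h0; rw [h0, mul_zero] at hprod; exact zero_ne_one hprod
    apply mul_right_cancel₀ hne
    linear_combination hprod + hprod'
  rw [← this, ← hIt, compl_compl]

theorem slope_ne_neg (h2 : (2 : F) ≠ 0) (h : IsSimpleAt σ x y z) {w : F} (hw : w ≠ x) :
    slope σ x w ≠ -slope σ x y := by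
  intro hs
  have hm : slope σ x y ≠ 0 := slope_perm_ne_zero σ h.ne_left
  by_cases hz : w = z
  · rw [hz, ← h.slope_eq] at hs
    exact hm ((mul_eq_zero.1 (by linear_combination hs : 2 * slope σ x y = 0)).resolve_left h2)
  · have : slope σ x w ∈ (({x, z} : Finset F)ᶜ).image (slope σ x) :=
      mem_image_of_mem _ (by simp [hw, hz])
    rw [h.image_slope] at this
    simp [hs] at this

theorem prod_comp_slope (h : IsSimpleAt σ x y z) (g : F → F) :
    ∏ w ∈ ({x, z} : Finset F)ᶜ, g (slope σ x w) = ∏ v ∈ ({0, -slope σ x y} : Finset F)ᶜ, g v := by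
  rw [← h.image_slope, prod_image]
  refine h.injOn.mono fun w hw => ?_
  simpa [and_comm] using hw

/-- Wilson's product of `v - u` over `v ≠ u`, with `u = slope σ x p`: the missed values `0` and `-m`
contribute the factor `u * (u + m)`. -/
theorem prod_slope_sub_slope (h2 : (2 : F) ≠ 0) (h : IsSimpleAt σ x y z) {p : F} (hp : p ≠ x)
    (hpz : p ≠ z) :
    (∏ w ∈ ({x, p, z} : Finset F)ᶜ, (slope σ x w - slope σ x p)) *
      (slope σ x p * (slope σ x p + slope σ x y)) = -1 := by
  set u := slope σ x p with hu
  set m := slope σ x y with hm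
  have hu0 : u ≠ 0 := slope_perm_ne_zero σ hp.symm
  have hm0 : m ≠ 0 := slope_perm_ne_zero σ h.ne_left
  have hum : u ≠ -m := h.slope_ne_neg h2 hp
  have hset : ∏ w ∈ ({x, p, z} : Finset F)ᶜ, (slope σ x w - u) =
      ∏ v ∈ ({0, -m, u} : Finset F)ᶜ, (v - u) := by
    -- Replacing the vanishing factor by `1` lets `p` and `u` be removed from the two index sets.
    have := h.prod_comp_slope (fun v => if v = u then 1 else v - u)
    rw [← mul_prod_erase _ _ (a := p) (by simp [hp, hpz]),
      ← mul_prod_erase (({0, -m} : Finset F)ᶜ) _ (a := u) (by simp [hu0, hum])] at this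
    simp only [← hu, if_true, one_mul] at this
    convert this using 1
    · have : ({x, p, z} : Finset F)ᶜ = (({x, z} : Finset F)ᶜ).erase p := by
        ext w; simp; tauto
      rw [this]
      refine prod_congr rfl fun w hw => ?_
      rw [if_neg]
      intro hs
      simp only [mem_erase, mem_compl, mem_insert, mem_singleton, not_or] at hw
      exact hw.1 (h.injOn ⟨hw.2.1, hw.2.2⟩ ⟨hp, hpz⟩ hs)
    · have : ({0, -m, u} : Finset F)ᶜ = (({0, -m} : Finset F)ᶜ).erase u := by
        ext w; simp; tauto
      rw [this]
      refine prod_congr rfl fun w hw => ?_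
      rw [if_neg (mem_erase.1 hw).1]
  rw [hset, ← prod_erase_sub_eq_neg_one u,
    ← mul_prod_erase (univ.erase u) _ (a := 0) (by simp [hu0.symm]),
    ← mul_prod_erase ((univ.erase u).erase 0) _ (a := -m) (by simp [hum.symm, hm0])]
  have : ({0, -m, u} : Finset F)ᶜ = ((univ.erase u).erase 0).erase (-m) := by
    ext w; simp; tauto
  rw [this]
  ring

theorem prod_slope_sub_slope_of_ne (h2 : (2 : F) ≠ 0) (h : IsSimpleAt σ x y z) {p : F}
    (hp : p ≠ x) (hs : slope σ x p ≠ slope σ x y) :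
    (∏ w ∈ ({x, p} : Finset F)ᶜ, (slope σ x w - slope σ x p)) *
      (slope σ x p * (slope σ x p + slope σ x y)) = slope σ x p - slope σ x y := by
  have hpz : p ≠ z := by rintro rfl; exact hs h.slope_eq.symm
  have h1 := h.prod_slope_sub_slope h2 hp hpz
  rw [← mul_prod_erase _ _ (a := z) (by simp [hpz.symm, h.ne_right.symm]), ← h.slope_eq]
  have : (({x, p} : Finset F)ᶜ).erase z = ({x, p, z} : Finset F)ᶜ := by
    ext w; simp; tauto
  rw [this]
  linear_combination (slope σ x y - slope σ x p) * h1

theorem slope_sq {y' z' x' : F} (h2 : (2 : F) ≠ 0) (h : IsSimpleAt σ x y z)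
    (h' : IsSimpleAt σ x' y' z') (hne : x ≠ x') :
    slope σ x x' ^ 2 = slope σ x y * slope σ x' y' := by
  -- If the joining line carries the triple of one point, it carries that of the other, and all
  -- three slopes agree.
  have key : ∀ {p q a b c d : F}, IsSimpleAt σ p a b → IsSimpleAt σ q c d → p ≠ q →
      slope σ p q = slope σ p a → slope σ q c = slope σ p q := by
    intro p q a b c d hp hq hpq hs
    obtain ⟨r, hr, hqr, hpr⟩ : ∃ r, r ≠ p ∧ q ≠ r ∧ slope σ p r = slope σ p q := by
      rcases hp.eq_or_eq hpq.symm hs with rfl | rfl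
      · exact ⟨b, hp.ne_right.symm, hp.ne, hp.slope_eq.symm⟩
      · exact ⟨a, hp.ne_left.symm, hp.ne.symm, hp.slope_eq⟩
    have h1 := slope_eq_slope_of_slope_eq σ hpq hr.symm hqr hpr.symm
    rw [← h1]
    refine (hq.slope_eq_of_slope_eq hqr.symm hpq hr ?_).symm
    rw [h1, slope_comm]
  by_cases hs : slope σ x x' = slope σ x y
  · rw [key h h' hne hs, ← hs, sq]
  by_cases hs' : slope σ x' x = slope σ x' y'
  · rw [key h' h hne.symm hs', ← hs', sq, slope_comm σ x' x]
  have e1 := h.prod_slope_sub_slope_of_ne h2 hne.symm hs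
  have e2 := h'.prod_slope_sub_slope_of_ne h2 hne hs'
  rw [pair_comm, slope_comm σ x' x] at e2
  have e3 : (∏ w ∈ ({x, x'} : Finset F)ᶜ, (slope σ x w - slope σ x x')) *
        ∏ w ∈ ({x, x'} : Finset F)ᶜ, (w - x) =
      (∏ w ∈ ({x, x'} : Finset F)ᶜ, (slope σ x' w - slope σ x x')) *
        ∏ w ∈ ({x, x'} : Finset F)ᶜ, (w - x') := by
    rw [← prod_mul_distrib, ← prod_mul_distrib]
    refine prod_congr rfl fun w hw => ?_
    simp only [mem_compl, mem_insert, mem_singleton, not_or] at hw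
    exact slope_sub_mul σ hw.1 hw.2 hne
  have e4 := mul_prod_compl_pair x x' hne
  have e5 := mul_prod_compl_pair x' x hne.symm
  rw [pair_comm] at e5
  have hu : slope σ x x' ≠ 0 := slope_perm_ne_zero σ hne
  generalize slope σ x x' = u at *
  generalize slope σ x y = m at *
  generalize slope σ x' y' = n at *
  generalize ∏ w ∈ ({x, x'} : Finset F)ᶜ, (slope σ x w - u) = L at *
  generalize ∏ w ∈ ({x, x'} : Finset F)ᶜ, (slope σ x' w - u) = L' at *
  generalize ∏ w ∈ ({x, x'} : Finset F)ᶜ, (w - x) = D at *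
  generalize ∏ w ∈ ({x, x'} : Finset F)ᶜ, (w - x') = D' at *
  -- The Wilson products give `(x' - x) * D = -1` and `(x - x') * D' = -1`, so `D = -D'`, and `L * D
  -- = L' * D'`.
  have e6 : L = -L' := by
    linear_combination -(x' - x) * e3 + L * e4 + L' * e5
  have e7 : 2 * (u * (u ^ 2 - m * n)) = 0 := by
    subst e6
    linear_combination -u * (u + n) * e1 - u * (u + m) * e2
  have := ((mul_eq_zero.1 e7).resolve_left h2)
  exact sub_eq_zero.1 ((mul_eq_zero.1 this).resolve_left hu)

/-- The shared slope makes the products of slope differences equal, so the products of `w - x` and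
`w - y` over the other `w` agree. Wilson's theorem then leaves `z - x = -(z - y)`. -/
theorem two_mul_eq_add (h2 : (2 : F) ≠ 0) (h : IsSimpleAt σ x y z) (h' : IsSimpleAt σ y x z) :
    2 * z = x + y := by
  have e1 := h.prod_slope_sub_slope h2 h.ne_left.symm h.ne
  have e2 := h'.prod_slope_sub_slope h2 h.ne_left h.ne_right
  rw [insert_comm, slope_comm σ y x] at e2
  have e3 : (∏ w ∈ ({x, y, z} : Finset F)ᶜ, (slope σ x w - slope σ x y)) *
        ∏ w ∈ ({x, y, z} : Finset F)ᶜ, (w - x) =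
      (∏ w ∈ ({x, y, z} : Finset F)ᶜ, (slope σ y w - slope σ x y)) *
        ∏ w ∈ ({x, y, z} : Finset F)ᶜ, (w - y) := by
    rw [← prod_mul_distrib, ← prod_mul_distrib]
    refine prod_congr rfl fun w hw => ?_
    simp only [mem_compl, mem_insert, mem_singleton, not_or] at hw
    exact slope_sub_mul σ hw.1 hw.2.1 h.ne_left
  have e4 := mul_prod_compl_pair x y h.ne_left
  have e5 := mul_prod_compl_pair y x h.ne_left.symm
  have hset : (({x, y} : Finset F)ᶜ).erase z = ({x, y, z} : Finset F)ᶜ := by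
    ext w; simp; tauto
  rw [pair_comm] at e5
  rw [← mul_prod_erase _ _ (a := z) (by simp [h.ne_right.symm, h.ne.symm]), hset] at e4 e5
  generalize slope σ x y = u at *
  generalize ∏ w ∈ ({x, y, z} : Finset F)ᶜ, (slope σ x w - u) = L at *
  generalize ∏ w ∈ ({x, y, z} : Finset F)ᶜ, (slope σ y w - u) = L' at *
  generalize ∏ w ∈ ({x, y, z} : Finset F)ᶜ, (w - x) = D at *
  generalize ∏ w ∈ ({x, y, z} : Finset F)ᶜ, (w - y) = D' at *
  have hk : u * (u + u) ≠ 0 := by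
    intro h0; rw [h0, mul_zero] at e1; exact one_ne_zero (neg_eq_zero.1 e1.symm)
  have hL : L = L' := mul_right_cancel₀ hk (e1.trans e2.symm)
  have hL0 : L ≠ 0 := by
    intro h0; rw [h0, zero_mul] at e1; exact one_ne_zero (neg_eq_zero.1 e1.symm)
  have hD : D = D' := mul_left_cancel₀ hL0 (by rw [e3, hL])
  have hD0 : (y - x) * D ≠ 0 := by
    intro h0
    have : (-1 : F) = 0 := by linear_combination (z - x) * h0 - e4
    exact one_ne_zero (neg_eq_zero.1 this)
  have : (y - x) * D * (2 * z - (x + y)) = 0 := by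
    subst hD
    linear_combination e4 - e5
  exact sub_eq_zero.1 ((mul_eq_zero.1 this).resolve_left hD0)

end IsSimpleAt

/-! ### Collinear triples as sets of first coordinates -/

section Triples

variable {F : Type*} [Field F]

/-- The points of the graph of `σ` over `T` lie on a common line. -/
def IsSlopeConstant (σ : Equiv.Perm F) (T : Finset F) : Prop :=
  ∃ m, ∀ x ∈ T, ∀ y ∈ T, x ≠ y → slope σ x y = m

variable [Fintype F]

open Classical in
/-- The projections to the first coordinate of the collinear triples of `σ`. -/
noncomputable def indexTriples (σ : Equiv.Perm F) : Finset (Finset F) :=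
  (univ.powersetCard 3).filter (IsSlopeConstant σ)

variable {σ : Equiv.Perm F}

theorem mem_indexTriples {T : Finset F} :
    T ∈ indexTriples σ ↔ #T = 3 ∧ IsSlopeConstant σ T := by
  simp [indexTriples, mem_powersetCard]

variable [DecidableEq F]

/-- The collinear triples through the graph point over `x`. -/
noncomputable def triplesAt (σ : Equiv.Perm F) (x : F) : Finset (Finset F) :=
  (indexTriples σ).filter (x ∈ ·)

theorem mem_triplesAt {T : Finset F} {x : F} :
    T ∈ triplesAt σ x ↔ T ∈ indexTriples σ ∧ x ∈ T := by
  simp [triplesAt]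

theorem triple_mem_indexTriples {x y z : F} (hxy : x ≠ y) (hxz : x ≠ z) (hyz : y ≠ z)
    (h : slope σ x y = slope σ x z) : {x, y, z} ∈ indexTriples σ := by
  refine mem_indexTriples.2 ⟨card_eq_three.2 ⟨x, y, z, hxy, hxz, hyz, rfl⟩, slope σ x y, ?_⟩
  have h1 := slope_eq_slope_of_slope_eq σ hxy hxz hyz h
  have h2 := slope_comm σ y x
  have h3 := slope_comm σ z x
  have h4 := slope_comm σ z y
  simp only [mem_insert, mem_singleton]
  rintro a (rfl | rfl | rfl) b (rfl | rfl | rfl) hab <;> first | exact absurd rfl hab | simp_all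

theorem triple_mem_triplesAt {x y z : F} (hxy : x ≠ y) (hxz : x ≠ z) (hyz : y ≠ z)
    (h : slope σ x y = slope σ x z) : {x, y, z} ∈ triplesAt σ x :=
  mem_triplesAt.2 ⟨triple_mem_indexTriples hxy hxz hyz h, by simp⟩

theorem exists_of_mem_triplesAt {T : Finset F} {x : F} (h : T ∈ triplesAt σ x) :
    ∃ y z, x ≠ y ∧ x ≠ z ∧ y ≠ z ∧ slope σ x y = slope σ x z ∧ T = {x, y, z} := by
  obtain ⟨h, hx⟩ := mem_triplesAt.1 h
  obtain ⟨h3, m, hm⟩ := mem_indexTriples.1 h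
  obtain ⟨y, z, hyz, hT⟩ := card_eq_two.1 (show #(T.erase x) = 2 by
    rw [card_erase_of_mem hx, h3])
  have hT' : T = {x, y, z} := by rw [← insert_erase hx, hT]
  have hy : y ∈ T.erase x := by simp [hT]
  have hz : z ∈ T.erase x := by simp [hT]
  rw [mem_erase] at hy hz
  exact ⟨y, z, hy.1.symm, hz.1.symm, hyz,
    (hm x hx y hy.2 hy.1.symm).trans (hm x hx z hz.2 hz.1.symm).symm, hT'⟩

theorem one_le_card_triplesAt (h2 : (2 : F) ≠ 0) (x : F) : 1 ≤ #(triplesAt σ x) := by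
  obtain ⟨y, z, hxy, hxz, hyz, h⟩ := exists_slope_eq h2 σ x
  exact card_pos.2 ⟨_, triple_mem_triplesAt hxy hxz hyz h⟩

theorem exists_isSimpleAt {x : F} (h : #(triplesAt σ x) = 1) :
    ∃ y z, IsSimpleAt σ x y z := by
  obtain ⟨T, hT⟩ := card_eq_one.1 h
  obtain ⟨y, z, hxy, hxz, hyz, hs, hTe⟩ :=
    exists_of_mem_triplesAt (σ := σ) (x := x) (T := T) (by rw [hT]; simp)
  refine ⟨y, z, hxy, hxz, hyz, hs, ?_⟩
  rintro v ⟨hv, hv'⟩ w ⟨hw, hw'⟩ hvw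
  by_contra hne
  have h1 := triple_mem_triplesAt (σ := σ) hv.symm hw.symm hne hvw
  rw [hT, mem_singleton, hTe] at h1
  have h2 : z ∈ ({x, v, w} : Finset F) := by rw [h1]; simp
  simp only [mem_insert, mem_singleton] at h2
  rcases h2 with h2 | h2 | h2
  · exact hxz h2.symm
  · exact hv' h2.symm
  · exact hw' h2.symm

theorem sum_card_triplesAt (σ : Equiv.Perm F) :
    ∑ x, #(triplesAt σ x) = 3 * #(indexTriples σ) := by
  simp only [triplesAt, card_filter]
  rw [sum_comm, mul_comm, ← smul_eq_mul, ← sum_const]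
  refine sum_congr rfl fun T hT => ?_
  rw [← card_filter, filter_univ_mem, (mem_indexTriples.1 hT).1]

end Triples

/-! ### Translation to collinearity in the plane -/

section Link

variable {F : Type*} [Field F] [DecidableEq F]

theorem collinear_image_graph_iff (σ : Equiv.Perm F) (T : Finset F) (hT : T.Nonempty) :
    Collinear F ((T.image fun x => (x, σ x) : Finset (F × F)) : Set (F × F)) ↔
      IsSlopeConstant σ T := by
  obtain ⟨x₀, hx₀⟩ := hT
  rw [collinear_iff_of_mem (p₀ := (x₀, σ x₀)) (by simpa using hx₀)]
  constructor
  · rintro ⟨v, hv⟩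
    have hv' : ∀ x ∈ T, ∃ r : F, x = r * v.1 + x₀ ∧ σ x = r * v.2 + σ x₀ := by
      intro x hx
      obtain ⟨r, hr⟩ := hv (x, σ x) (by simpa using hx)
      exact ⟨r, congrArg Prod.fst hr, congrArg Prod.snd hr⟩
    refine ⟨v.2 / v.1, fun x hx y hy hxy => ?_⟩
    obtain ⟨r, hr, hr'⟩ := hv' x hx
    obtain ⟨s, hs, hs'⟩ := hv' y hy
    have h1 : y - x = (s - r) * v.1 := by rw [hr, hs]; ring
    have h2 : σ y - σ x = (s - r) * v.2 := by rw [hr', hs']; ring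
    have h3 : y - x ≠ 0 := sub_ne_zero.2 hxy.symm
    rw [slope_def_field, h2, h1]
    rw [h1] at h3
    exact mul_div_mul_left _ _ (left_ne_zero_of_mul h3)
  · rintro ⟨m, hm⟩
    refine ⟨(1, m), fun p hp => ?_⟩
    obtain ⟨x, hx, rfl⟩ := mem_image.1 (mem_coe.1 hp)
    refine ⟨x - x₀, Prod.ext (by simp) ?_⟩
    by_cases hxx : x₀ = x
    · simp [hxx]
    · have h1 := hm x₀ hx₀ x hx hxx
      rw [slope_def_field, div_eq_iff (sub_ne_zero.2 (Ne.symm hxx))] at h1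
      simp only [smul_eq_mul, vadd_eq_add, Prod.smul_mk, Prod.mk_add_mk]
      linear_combination h1

variable [Fintype F]

theorem ncard_collinearTriples (σ : Equiv.Perm F) :
    (collinearTriples σ).ncard = #(indexTriples σ) := by
  have hinj : Function.Injective fun x : F => (x, σ x) := fun x y h => congrArg Prod.fst h
  have h : collinearTriples σ =
      (fun T : Finset F => T.image fun x => (x, σ x)) '' (indexTriples σ : Set (Finset F)) := by
    ext S
    simp only [collinearTriples, Set.mem_ofPred_eq, Set.mem_image, mem_coe, mem_indexTriples]
    constructor
    · rintro ⟨h3, hsub, hcol⟩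
      have hS : (S.image Prod.fst).image (fun x => (x, σ x)) = S := by
        rw [image_image]
        conv_rhs => rw [← image_id (s := S)]
        exact image_congr fun p hp => Prod.ext rfl (hsub hp).symm
      have hc : #(S.image Prod.fst) = 3 := by
        rw [← h3]
        conv_rhs => rw [← hS]
        rw [card_image_of_injective _ hinj]
      refine ⟨_, ⟨hc, ?_⟩, hS⟩
      rw [← collinear_image_graph_iff σ _ (card_pos.1 (by omega)), hS]
      exact hcol
    · rintro ⟨T, ⟨h3, hT⟩, rfl⟩
      refine ⟨by rw [card_image_of_injective _ hinj, h3], ?_, ?_⟩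
      · intro p hp
        obtain ⟨x, -, rfl⟩ := mem_image.1 (mem_coe.1 hp)
        rfl
      · exact (collinear_image_graph_iff σ T (card_pos.1 (by omega))).2 hT
  rw [h, Set.ncard_image_of_injective _ (image_injective hinj), Set.ncard_coe_finset]

end Link

/-- Relative to `i₁` each difference agrees up to sign, and the signs cannot be mixed: one index
with the minus sign forces it on all. -/
theorem exists_affine_of_sq_sub_eq {ι F : Type*} [Field F] {A : Finset ι}
    {f g : ι → F} (h : ∀ i ∈ A, ∀ j ∈ A, (f i - f j) ^ 2 = (g i - g j) ^ 2) :
    ∃ ε k : F, ε ^ 2 = 1 ∧ ∀ i ∈ A, f i = ε * g i + k := by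
  rcases A.eq_empty_or_nonempty with rfl | ⟨i₁, h₁⟩
  · exact ⟨1, 0, by simp, by simp⟩
  by_cases hall : ∀ i ∈ A, f i - f i₁ = g i - g i₁
  · exact ⟨1, f i₁ - g i₁, by simp, fun i hi => by linear_combination hall i hi⟩
  push Not at hall
  obtain ⟨i₂, h₂, hne⟩ := hall
  have h12 := (sq_eq_sq_iff_eq_or_eq_neg.1 (h i₂ h₂ i₁ h₁)).resolve_left hne
  refine ⟨-1, f i₁ + g i₁, by simp, fun i hi => ?_⟩
  rcases sq_eq_sq_iff_eq_or_eq_neg.1 (h i hi i₁ h₁) with h3 | h3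
  · rcases sq_eq_sq_iff_eq_or_eq_neg.1 (h i hi i₂ h₂) with h4 | h4
    · exact absurd (by linear_combination h3 - h4) hne
    · linear_combination h4 + h12
  · linear_combination h3

/-! ### The hyperbola through the simple points -/

section Hyperbola

variable {F : Type*} [Field F] [Fintype F] [DecidableEq F] {σ : Equiv.Perm F}

theorem exists_hyperbola (h2 : (2 : F) ≠ 0) {A : Finset F}
    (hA : ∀ x ∈ A, ∃ y z, IsSimpleAt σ x y z) (hcard : 4 ≤ #A) :
    ∃ a b c ε : F, c ≠ 0 ∧ ε ^ 2 = 1 ∧ ∀ x ∈ A, (x - a) * (σ x - b) = c ∧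
      ∀ y z, IsSimpleAt σ x y z → slope σ x y * (x - a) ^ 2 = ε * c := by
  obtain ⟨p, hp⟩ : A.Nonempty := card_pos.1 (by omega)
  obtain ⟨y₀, z₀, h₀⟩ := hA p hp
  set m := slope σ p y₀ with hm
  have hm0 : m ≠ 0 := slope_perm_ne_zero σ h₀.ne_left
  have hpx : ∀ {u v : F}, u ≠ v → σ u - σ v ≠ 0 := fun h =>
    sub_ne_zero.2 fun e => h (σ.injective e)
  have hsl : ∀ x ∈ A, x ≠ p → ∀ y z, IsSimpleAt σ x y z →
      slope σ x y = ((σ x - σ p) / (x - p)) ^ 2 / m := by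
    intro x hx hxp y z h
    rw [eq_div_iff hm0, ← slope_def_field, h₀.slope_sq h2 h hxp.symm, ← hm, mul_comm]
  -- Dividing `slope_sq` for `x` and `w` by suitable squares says that `m / (σ x - σ p)` and `1 / (x
  -- - p)` have equal squared differences.
  obtain ⟨ε, k, hε, hk⟩ := exists_affine_of_sq_sub_eq (A := A.erase p)
    (f := fun x => m / (σ x - σ p)) (g := fun x => 1 / (x - p)) (by
      intro x hx w hw
      obtain ⟨hxp, hx⟩ := mem_erase.1 hx
      obtain ⟨hwp, hw⟩ := mem_erase.1 hw
      by_cases hxw : x = w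
      · simp [hxw]
      obtain ⟨y, z, h⟩ := hA x hx
      obtain ⟨y', z', h'⟩ := hA w hw
      have h3 := h.slope_sq h2 h' hxw
      rw [hsl x hx hxp y z h, hsl w hw hwp y' z' h', slope_def_field] at h3
      have e1 := sub_ne_zero.2 hxp
      have e2 := sub_ne_zero.2 hwp
      have e3 := sub_ne_zero.2 (Ne.symm hxw)
      have e4 := hpx hxp
      have e5 := hpx hwp
      rw [div_sub_div _ _ e4 e5, div_sub_div _ _ e1 e2]
      generalize hX : x - p = X at *
      generalize hW : w - p = W at *
      generalize hY : σ x - σ p = Y at *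
      generalize hV : σ w - σ p = V at *
      have e6 : w - x = W - X := by rw [← hX, ← hW]; ring
      have e7 : σ w - σ x = V - Y := by rw [← hY, ← hV]; ring
      rw [e6] at e3
      rw [e6, e7] at h3
      field_simp at h3 ⊢
      linear_combination h3)
  -- With `k = 0` all slopes from `p` would be `ε * m`; slope `m` occurs only at `y₀`, `z₀` and `-m`
  -- never, so `A` would have at most three points.
  have hk0 : k ≠ 0 := by
    rintro rfl
    have hsub : A ⊆ {p, y₀, z₀} := by
      intro x hx
      by_cases hxp : x = p
      · simp [hxp]
      have h3 := hk x (mem_erase.2 ⟨hxp, hx⟩)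
      have e1 := sub_ne_zero.2 hxp
      have e4 := hpx hxp
      have h4 : slope σ p x = ε * m := by
        rw [slope_def_field, div_eq_iff e1]
        field_simp at h3
        linear_combination (-ε) * h3 - (σ x - σ p) * hε
      rcases sq_eq_one_iff.1 hε with rfl | rfl
      · rw [one_mul] at h4
        rcases h₀.eq_or_eq hxp h4 with rfl | rfl <;> simp
      · exact absurd (by rw [h4]; ring) (h₀.slope_ne_neg h2 hxp)
    have := (card_le_card hsub).trans card_le_three
    omega
  have hε0 : ε ≠ 0 := by rintro rfl; simp at hε
  -- Completing the product in `m * X = Y * (ε + k * X)`, where `X = x - p` and `Y = σ x - σ p`.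
  refine ⟨p - ε / k, σ p + m / k, -ε * m / k ^ 2, -ε, ?_, by rw [neg_sq, hε], ?_⟩
  · exact div_ne_zero (mul_ne_zero (neg_ne_zero.2 hε0) hm0) (pow_ne_zero _ hk0)
  intro x hx
  by_cases hxp : x = p
  · subst hxp
    constructor
    · field_simp
      ring
    · intro y z h
      have hxy : slope σ x y = m := by
        exact (h.slope_eq_of_slope_eq h₀.ne_left.symm h₀.ne_right.symm h₀.ne h₀.slope_eq).symm
      rw [hxy]
      field_simp
      ring
  have h3 := hk x (mem_erase.2 ⟨hxp, hx⟩)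
  have e1 := sub_ne_zero.2 hxp
  have e4 := hpx hxp
  have h4 : m * (x - p) = (σ x - σ p) * (ε + k * (x - p)) := by
    field_simp at h3
    linear_combination h3
  constructor
  · field_simp
    linear_combination (-k) * h4
  · intro y z h
    rw [hsl x hx hxp y z h]
    field_simp
    have h5 : (σ x - σ p) ^ 2 * (k * (x - p) + ε) ^ 2 = m ^ 2 * (x - p) ^ 2 := by
      rw [← mul_pow, ← mul_pow, h4]; ring
    linear_combination h5 - m ^ 2 * (x - p) ^ 2 * hε

/-- Equal repeated slopes put `p` and `q` symmetrically about `a`. The third point of the triple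
lies over their midpoint, hence over `a`; being collinear with two points symmetric about the
centre, it is the centre. -/
theorem eq_center_of_mem_triplesAt (h2 : (2 : F) ≠ 0) {a b c ε p q : F} (hc : c ≠ 0)
    (hp : (p - a) * (σ p - b) = c) (hq : (q - a) * (σ q - b) = c)
    (hp' : ∀ y z, IsSimpleAt σ p y z → slope σ p y * (p - a) ^ 2 = ε * c)
    (hq' : ∀ y z, IsSimpleAt σ q y z → slope σ q y * (q - a) ^ 2 = ε * c)
    (hps : ∃ y z, IsSimpleAt σ p y z) (hqs : ∃ y z, IsSimpleAt σ q y z) (hpq : p ≠ q)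
    {T : Finset F} (hTp : T ∈ triplesAt σ p) (hTq : T ∈ triplesAt σ q) :
    σ a = b ∧ ε = 1 := by
  obtain ⟨r, hpr, hqr, hs⟩ : ∃ r, p ≠ r ∧ q ≠ r ∧ slope σ p q = slope σ p r := by
    obtain ⟨y, z, hxy, hxz, hyz, hs, rfl⟩ := exists_of_mem_triplesAt hTp
    have hq := (mem_triplesAt.1 hTq).2
    simp only [mem_insert, mem_singleton] at hq
    rcases hq with rfl | rfl | rfl
    · exact absurd rfl hpq
    · exact ⟨z, hxz, hyz, hs⟩
    · exact ⟨y, hxy, hyz.symm, hs.symm⟩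
  obtain ⟨_, _, hps⟩ := hps
  obtain ⟨_, _, hqs⟩ := hqs
  replace hps := hps.of_slope_eq hpq.symm hpr.symm hqr hs
  replace hqs := hqs.of_slope_eq hpq hqr.symm hpr
    (by rw [slope_comm, slope_eq_slope_of_slope_eq σ hpq hpr hqr hs])
  have hr := hps.two_mul_eq_add h2 hqs
  replace hp' := hp' _ _ hps
  replace hq' := hq' _ _ hqs
  rw [slope_comm] at hq'
  have hu := slope_perm_ne_zero σ hpq
  have hpa : p - a ≠ 0 := by intro h; rw [h, zero_mul] at hp; exact hc hp.symm
  have hsum : p - a = -(q - a) := by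
    have h1 : (p - a) ^ 2 = (q - a) ^ 2 := mul_left_cancel₀ hu (hp'.trans hq'.symm)
    refine (sq_eq_sq_iff_eq_or_eq_neg.1 h1).resolve_left fun h => hpq ?_
    linear_combination h
  have hra : r = a := mul_left_cancel₀ h2 (by linear_combination hr + hsum)
  subst hra
  have e1 : slope σ p q * (q - p) = σ q - σ p := by
    rw [slope_def_field, div_mul_cancel₀ _ (sub_ne_zero.2 hpq.symm)]
  have e2 : slope σ p q * (r - p) = σ r - σ p := by
    rw [hs, slope_def_field, div_mul_cancel₀ _ (sub_ne_zero.2 hpr.symm)]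
  have e3 : slope σ p q * (p - r) ^ 2 = c := by
    refine mul_left_cancel₀ h2 ?_
    have hqe : q = 2 * r - p := by linear_combination hsum
    have hσ : (p - r) * (σ q - b) = -c := by rw [hqe] at hq ⊢; linear_combination -hq
    have e1' : slope σ p q * (2 * (r - p)) = σ q - σ p := by rw [← e1, hqe]; ring
    linear_combination (-(p - r)) * e1' - hσ + hp
  constructor
  · refine mul_left_cancel₀ hpa ?_
    linear_combination (-(p - r)) * e2 - e3 + hp
  · refine mul_right_cancel₀ hc ?_
    rw [← hp', e3, one_mul]

end Hyperbola

/-! ### Counting, equality and the extremal example -/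

section Counting

variable {F : Type*} [Field F] [Fintype F] [DecidableEq F] {σ : Equiv.Perm F}

/-- The points over which the graph of `σ` meets exactly one collinear triple. -/
noncomputable def simplePoints (σ : Equiv.Perm F) : Finset F :=
  univ.filter fun x => #(triplesAt σ x) = 1

theorem mem_simplePoints {x : F} : x ∈ simplePoints σ ↔ #(triplesAt σ x) = 1 := by
  simp [simplePoints]

theorem two_mul_card_le_sum_add (h2 : (2 : F) ≠ 0) (S : Finset F) :
    2 * #S ≤ ∑ x ∈ S, #(triplesAt σ x) + #(simplePoints σ) := by
  calc 2 * #S = ∑ x ∈ S, 2 := by rw [sum_const, smul_eq_mul, mul_comm]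
    _ ≤ ∑ x ∈ S, (#(triplesAt σ x) + if x ∈ simplePoints σ then 1 else 0) := by
        refine sum_le_sum fun x _ => ?_
        have := one_le_card_triplesAt (σ := σ) h2 x
        split_ifs with hx
        · omega
        · rw [mem_simplePoints] at hx
          omega
    _ ≤ _ := by
        rw [sum_add_distrib, ← card_filter]
        gcongr
        intro x hx
        exact (mem_filter.1 hx).2

theorem card_simplePoints_le_of_disjoint
    (h : ∀ p ∈ simplePoints σ, ∀ q ∈ simplePoints σ, p ≠ q →
      Disjoint (triplesAt σ p) (triplesAt σ q)) :
    #(simplePoints σ) ≤ #(indexTriples σ) := by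
  have h1 : #(simplePoints σ) = #((simplePoints σ).biUnion (triplesAt σ)) := by
    rw [card_biUnion h, sum_congr rfl fun x hx => mem_simplePoints.1 hx]
    simp
  rw [h1]
  refine card_le_card (biUnion_subset.2 fun x _ T hT => (mem_triplesAt.1 hT).1)

theorem card_simplePoints_le_two_mul {a : F} (ha : a ∉ simplePoints σ)
    (h : ∀ x ∈ simplePoints σ, triplesAt σ x ⊆ triplesAt σ a) :
    #(simplePoints σ) ≤ 2 * #(triplesAt σ a) := by
  calc #(simplePoints σ) = ∑ x ∈ simplePoints σ, #(triplesAt σ x) := by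
        rw [sum_congr rfl fun x hx => mem_simplePoints.1 hx]
        simp
    _ = ∑ x ∈ simplePoints σ, #((triplesAt σ a).filter (x ∈ ·)) := by
        refine sum_congr rfl fun x hx => ?_
        congr 1
        ext T
        have h1 := @h x hx T
        simp only [mem_filter, mem_triplesAt] at h1 ⊢
        tauto
    _ = ∑ T ∈ triplesAt σ a, #((simplePoints σ).filter (· ∈ T)) := by
        simp only [card_filter]
        rw [sum_comm]
    _ ≤ ∑ T ∈ triplesAt σ a, 2 := by
        refine sum_le_sum fun T hT => ?_
        obtain ⟨hT, haT⟩ := mem_triplesAt.1 hT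
        have h1 : (simplePoints σ).filter (· ∈ T) ⊆ T.erase a := by
          intro x hx
          obtain ⟨hx, hxT⟩ := mem_filter.1 hx
          exact mem_erase.2 ⟨fun e => ha (e ▸ hx), hxT⟩
        refine (card_le_card h1).trans ?_
        rw [card_erase_of_mem haT, (mem_indexTriples.1 hT).1]
    _ = _ := by rw [sum_const, smul_eq_mul, mul_comm]

theorem isELFTP_of_card_eq_three (h : Fintype.card F = 3) (h2 : (2 : F) ≠ 0)
    (σ : Equiv.Perm F) : IsELFTP σ := by
  have hne : (1 : F) ≠ -1 := fun e => h2 (by linear_combination e)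
  have huniv : ∀ x : F, x = 0 ∨ x = 1 ∨ x = -1 := by
    intro x
    have h3 : ({0, 1, -1} : Finset F) = univ := by
      rw [← card_eq_iff_eq_univ, h, card_eq_three]
      exact ⟨0, 1, -1, by simp, by simp, hne, rfl⟩
    have := mem_univ x
    rw [← h3] at this
    simpa using this
  have h01 : σ 1 - σ 0 ≠ 0 := sub_ne_zero.2 fun e => one_ne_zero (σ.injective e)
  refine ⟨σ 0, σ 1 - σ 0, 0, by simpa using h01.symm, fun x hx => ?_, by simp⟩
  rw [neg_zero] at hx
  rcases huniv x with rfl | rfl | rfl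
  · exact absurd rfl hx
  · simp
  · have h4 : σ (-1) - σ 0 ≠ 0 := sub_ne_zero.2 fun e => by simpa using σ.injective e
    have h5 : σ (-1) - σ 0 ≠ σ 1 - σ 0 := fun e => hne (σ.injective (sub_left_injective e)).symm
    have h6 : σ (-1) - σ 0 = -(σ 1 - σ 0) := by
      rcases huniv (σ (-1) - σ 0) with e | e | e <;> rcases huniv (σ 1 - σ 0) with e' | e' | e' <;>
        simp_all
    simp only [add_zero, div_neg, div_one]
    linear_combination h6

theorem card_sub_one_le_and_isELFTP (h2 : (2 : F) ≠ 0) (hodd : Odd (Fintype.card F))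
    (σ : Equiv.Perm F) :
    Fintype.card F - 1 ≤ 2 * #(indexTriples σ) ∧
      (Fintype.card F - 1 = 2 * #(indexTriples σ) → IsELFTP σ) := by
  have hq1 := Fintype.one_lt_card (α := F)
  have hq3 : 3 ≤ Fintype.card F := by
    obtain ⟨k, hk⟩ := hodd
    omega
  have hsum := sum_card_triplesAt σ
  have hU := two_mul_card_le_sum_add (σ := σ) h2 univ
  rw [card_univ, hsum] at hU
  by_cases hn : 4 ≤ #(simplePoints σ)
  swap
  -- With at most three simple points, `2q ≤ 3N + 3` gives a strict bound unless `q = 3`, where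
  -- every permutation is an ELFTP.
  · rcases hq3.eq_or_lt with hq | hq
    · exact ⟨by omega, fun _ => isELFTP_of_card_eq_three hq.symm h2 σ⟩
    · have : 5 ≤ Fintype.card F := by
        obtain ⟨k, hk⟩ := hodd
        omega
      exact ⟨by omega, by omega⟩
  have hS : ∀ x ∈ simplePoints σ, ∃ y z, IsSimpleAt σ x y z := fun x hx =>
    exists_isSimpleAt (mem_simplePoints.1 hx)
  obtain ⟨a, b, c, ε, hc, hε, hyp⟩ := exists_hyperbola h2 hS hn
  by_cases hcen : σ a = b ∧ ε = 1
  swap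
  · have h1 := card_simplePoints_le_of_disjoint (σ := σ) fun p hp q hq hpq =>
      disjoint_left.2 fun T hTp hTq => hcen <|
        eq_center_of_mem_triplesAt h2 hc (hyp p hp).1 (hyp q hq).1 (hyp p hp).2 (hyp q hq).2
          (hS p hp) (hS q hq) hpq hTp hTq
    exact ⟨by omega, by omega⟩
  obtain ⟨rfl, rfl⟩ := hcen
  have ha : a ∉ simplePoints σ := by
    intro ha
    have := (hyp a ha).1
    rw [sub_self, zero_mul] at this
    exact hc this.symm
  have hxa : ∀ x ∈ simplePoints σ, x ≠ a := fun x hx e => ha (e ▸ hx)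
  have h1 : #(simplePoints σ) ≤ 2 * #(triplesAt σ a) := by
    refine card_simplePoints_le_two_mul ha fun x hx T hT => ?_
    have hx0 := sub_ne_zero.2 (hxa x hx)
    obtain ⟨_, _, hs⟩ := hS x hx
    refine mem_triplesAt.2 ⟨(mem_triplesAt.1 hT).1, ?_⟩
    obtain ⟨y, z, hxy, hxz, hyz, hyz', rfl⟩ := exists_of_mem_triplesAt hT
    replace hs := hs.of_slope_eq hxy.symm hxz.symm hyz hyz'
    -- As `ε = 1`, the repeated slope `c / (x - a) ^ 2` is that of the line to the centre.
    have h3 : slope σ x a = slope σ x y := by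
      refine mul_right_cancel₀ (pow_ne_zero 2 hx0) ?_
      rw [(hyp x hx).2 y z hs, slope_comm, slope_def_field, ← (hyp x hx).1]
      field_simp
    rcases hs.eq_or_eq (hxa x hx).symm h3 with rfl | rfl <;> simp
  have h3 := two_mul_card_le_sum_add (σ := σ) h2 (univ.erase a)
  rw [card_erase_of_mem (mem_univ a), card_univ] at h3
  rw [← add_sum_erase univ _ (mem_univ a)] at hsum
  have hsub : simplePoints σ ⊆ univ.erase a := fun x hx => mem_erase.2 ⟨hxa x hx, mem_univ x⟩
  have h4 := card_le_card hsub
  rw [card_erase_of_mem (mem_univ a), card_univ] at h4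
  refine ⟨by omega, fun heq => ?_⟩
  have h5 : simplePoints σ = univ.erase a := by
    refine eq_of_subset_of_card_le hsub ?_
    rw [card_erase_of_mem (mem_univ a), card_univ]
    omega
  refine ⟨σ a, c - σ a * a, -a, ?_, fun x hx => ?_, by rw [neg_neg]⟩
  · intro h
    exact hc (by linear_combination -h)
  · rw [neg_neg] at hx
    have h6 := (hyp x (by rw [h5]; simp [hx])).1
    have hx0 : x + -a ≠ 0 := by rw [← sub_eq_add_neg]; exact sub_ne_zero.2 hx
    rw [eq_div_iff hx0]
    linear_combination h6

/-- The slope between nonzero `x` and `y` is `-1 / (x * y)`, so every triple contains `0` and has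
the form `{x, 0, -x}`. Thus `t 0 = N` and `t x ≤ 1` elsewhere, and `3N ≤ N + (q - 1)`. -/
theorem two_mul_card_indexTriples_inv_le :
    2 * #(indexTriples (Equiv.inv F)) ≤ Fintype.card F - 1 := by
  have hsl : ∀ {x y : F}, x ≠ 0 → y ≠ 0 → x ≠ y → slope (Equiv.inv F) x y * (x * y) = -1 := by
    intro x y hx hy hxy
    have := sub_ne_zero.2 hxy.symm
    rw [slope_def_field, Equiv.inv_apply]
    field_simp
    ring
  have h0 : ∀ T ∈ indexTriples (Equiv.inv F), (0 : F) ∈ T := by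
    intro T hT
    by_contra h0
    obtain ⟨x, hx⟩ : T.Nonempty := card_pos.1 (by rw [(mem_indexTriples.1 hT).1]; omega)
    obtain ⟨y, z, hxy, hxz, hyz, hs, rfl⟩ := exists_of_mem_triplesAt (mem_triplesAt.2 ⟨hT, hx⟩)
    simp only [mem_insert, mem_singleton, not_or] at h0
    have hx0 := Ne.symm h0.1
    have hy0 := Ne.symm h0.2.1
    have hz0 := Ne.symm h0.2.2
    have h1 := (hsl hx0 hy0 hxy).trans (hsl hx0 hz0 hxz).symm
    rw [hs] at h1
    exact hyz (mul_left_cancel₀ hx0 (mul_left_cancel₀ (slope_perm_ne_zero _ hxz) h1))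
  have hle : ∀ x ∈ univ.erase (0 : F), #(triplesAt (Equiv.inv F) x) ≤ 1 := by
    intro x hx
    have hx0 : x ≠ 0 := (mem_erase.1 hx).1
    have key : ∀ w, w ≠ 0 → x ≠ w →
        slope (Equiv.inv F) x 0 = slope (Equiv.inv F) x w → w = -x := by
      intro w hw hxw h
      have h1 := hsl hx0 hw hxw
      rw [← h, slope_def_field, Equiv.inv_apply] at h1
      field_simp at h1
      simp at h1
      rw [← h1, neg_neg]
    have hT : ∀ T ∈ triplesAt (Equiv.inv F) x, T = {x, 0, -x} := by
      intro T hT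
      have hT0 := h0 T (mem_triplesAt.1 hT).1
      obtain ⟨y, z, hxy, hxz, hyz, hs, rfl⟩ := exists_of_mem_triplesAt hT
      simp only [mem_insert, mem_singleton] at hT0
      rcases hT0 with rfl | rfl | rfl
      · exact absurd rfl hx0
      · rw [key z hyz.symm hxz hs]
      · rw [key y hyz hxy hs.symm, pair_comm]
    exact card_le_one.2 fun T hT' S hS => (hT T hT').trans (hT S hS).symm
  have hsum := sum_card_triplesAt (Equiv.inv F)
  rw [← add_sum_erase univ _ (mem_univ (0 : F))] at hsum
  have h3 := sum_le_sum hle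
  rw [sum_const, card_erase_of_mem (mem_univ _), card_univ, smul_eq_mul, mul_one] at h3
  have h4 : #(triplesAt (Equiv.inv F) 0) = #(indexTriples (Equiv.inv F)) := by
    rw [triplesAt, filter_true_of_mem h0]
  omega

end Counting

theorem theorem2p6 {F : Type*} [Field F] [Fintype F] (q : ℕ) (hF : Fintype.card F = q)
    (hq : Odd q) :
    IsLeast (Set.range fun τ : Equiv.Perm F => (collinearTriples τ).ncard) ((q - 1) / 2) ∧
    ∀ σ : Equiv.Perm F, (collinearTriples σ).ncard = (q - 1) / 2 → IsELFTP σ := by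
  classical
  subst hF
  have h2 : (2 : F) ≠ 0 := by
    refine Ring.two_ne_zero fun h => ?_
    rw [FiniteField.even_card_iff_char_two] at h
    exact (Nat.not_even_iff_odd.2 hq) (Nat.even_iff.2 h)
  simp only [ncard_collinearTriples]
  have hmain := card_sub_one_le_and_isELFTP h2 hq
  obtain ⟨k, hk⟩ := id hq
  refine ⟨⟨⟨Equiv.inv F, ?_⟩, ?_⟩, fun σ hσ => (hmain σ).2 (by omega)⟩
  · have h3 := two_mul_card_indexTriples_inv_le (F := F)
    have h4 := (hmain (Equiv.inv F)).1
    dsimp only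
    omega
  · rintro _ ⟨σ, rfl⟩
    have h4 := (hmain σ).1
    dsimp only
    omega
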